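/- **Setting.** Let $\Omega\subset\mathbb R^d$ be a space or space-time domain (for example a bounded open set with smooth boundary, or a cylinder $\Omega'\times[0,T]$ over one; it is only required that $\Omega\subset\overline{\operatorname{int}\Omega}$ and that derivatives within $\Omega$ and within $\overline\Omega$ are uniquely determined), and let $\Omega_m\subset\overline\Omega$ be a measurement set. Consider the problem $\mathcal N(u,s)=0$ in $\Omega$, $\mathcal B(u)=0$ on $\partial\Omega$, where $\mathcal N(u,s)(x)$ is an arbitrary (possibly nonlinear) function of $x$, of the derivatives of $u$ at $x$ up to order $n$ and of the derivatives of $s$ at $x$ up to order $m$, and $\mathcal B(u)(x)$ is an arbitrary function of $x$ and of the derivatives of $u$ at $x$ up to order $r$ (taken within $\overline\Omega$). Let $(u^{(i)},s^{(i)})$, $i=1,\dots,N$, be classical solutions of this problem with $u^{(i)}\in C^n(\Omega)\cap C^r(\overline\Omega)$ and $s^{(i)}\in C^m(\Omega)$. Fix collocation points $x_k\in\Omega$ ($k\le K$), $z_j\in\partial\Omega$ ($j\le M$) and measurement points $y_l\in\Omega_m$ ($l\le L$), and let $Y^{(i)}=(u^{(i)}(y_1),\dots,u^{(i)}(y_L))$.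 A PI-DION consists of two branch networks $b_\eta,b_\zeta:\mathbb R^L\to\mathbb R^p$ and a trunk network $t_\theta:\mathbb R^d\to\mathbb R^p$, all fully connected networks with affine output layer, and it produces $$u^{(i)}_{\eta,\theta}(x)=b_\eta(Y^{(i)})\cdot t_\theta(x),\qquad s^{(i)}_{\zeta,\theta}(x)=b_\zeta(Y^{(i)})\cdot t_\theta(x).$$ Its losses are $$\mathcal L_{physics}=\frac1{NK}\sum_{i=1}^N\sum_{k=1}^K\big[\mathcal N(u^{(i)}_{\eta,\theta},s^{(i)}_{\zeta,\theta})(x_k)\big]^2+\frac1{NM}\sum_{i=1}^N\sum_{j=1}^M\big[\mathcal B(u^{(i)}_{\eta,\theta})(z_j)\big]^2,\qquad \mathcal L_{data}=\frac1{NL}\sum_{i=1}^N\sum_{l=1}^L\big[u^{(i)}_{\eta,\theta}(y_l)-u^{(i)}(y_l)\big]^2 .$$ **Proposition.** Assume that the activation functions of the two branch networks are continuous and not polynomials, and that the activation function of the trunk network is not a polynomial and is $q$ times continuously differentiable, where $q=\max(n,m,r)$, so that $\mathcal N$ and $\mathcal B$ can be applied to the network outputs (for $q=0$ this is just continuity).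 Prescribe the number ($\ge1$) of hidden layers of each of the three networks. Then for any such data set, any such points and any $\varepsilon>0$ there exist $p$, hidden layer widths and parameters $\eta,\zeta,\theta$ such that $$\mathcal L=\mathcal L_{physics}+\mathcal L_{data}\le\varepsilon .$$ -/

import Mathlib

namespace PIDION

noncomputable section

/-! ### Fully connected networks -/

/-- Parameters (weights and biases) of a fully connected network `ℝ^a → ℝ^b` with `D` hidden layers.
The widths of the hidden layers are part of the data. -/
inductive MLP : ℕ → ℕ → ℕ → Type
  /-- the affine output layer -/
  | output {a b : ℕ} (W : Matrix (Fin b) (Fin a) ℝ) (c : Fin b → ℝ) : MLP 0 a b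
  /-- a hidden layer of width `h`, followed by the remaining layers -/
  | hidden {D a h b : ℕ} (W : Matrix (Fin h) (Fin a) ℝ) (c : Fin h → ℝ) (rest : MLP D h b) :
      MLP (D + 1) a b

/-- The function computed by a network: every hidden layer is `x ↦ σ (W x + c)` (with `σ` applied
to each entry), and the output layer is `x ↦ W x + c`. -/
def MLP.eval (σ : ℝ → ℝ) : {D a b : ℕ} → MLP D a b → (Fin a → ℝ) → (Fin b → ℝ)
  | _, _, _, .output W c, x => W.mulVec x + c
  | _, _, _, .hidden W c rest, x => rest.eval σ (fun j => σ ((W.mulVec x + c) j))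

/-- `σ` is not (the function of) a polynomial. -/
def NonPolynomial (σ : ℝ → ℝ) : Prop :=
  ¬ ∃ q : Polynomial ℝ, ∀ x : ℝ, σ x = q.eval x

/-! ### The inverse problem -/

/-- Values for all derivatives of orders `0, …, n` of a real function at a point of `ℝ^d`. -/
abbrev Jet (d n : ℕ) : Type :=
  (i : Fin (n + 1)) → EuclideanSpace ℝ (Fin d) [×(i : ℕ)]→L[ℝ] ℝ

/-- All derivatives of `f` of orders `0, …, n` at `x`, taken within the set `S`. For `x` in the
interior of `S` these are the usual derivatives. -/
def jetWithin {d : ℕ} (n : ℕ) (f : EuclideanSpace ℝ (Fin d) → ℝ)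
    (S : Set (EuclideanSpace ℝ (Fin d))) (x : EuclideanSpace ℝ (Fin d)) : Jet d n :=
  fun i => iteratedFDerivWithin ℝ (i : ℕ) f S x

/-- The data of a generic, possibly nonlinear, boundary value problem `𝓝(u, s) = 0` in `Ω`,
`𝓑(u) = 0` on `∂Ω`, with a measurement set `Ωm ⊆ closure Ω`. The three conditions on `Ω` hold for
an open set with smooth boundary and for space-time cylinders `Ω' × [0, T]` over such a set: `Ω`
has no thin parts, and derivatives within `Ω` and within its closure are unique. -/
structure InverseProblem (d : ℕ) where
  Ω : Set (EuclideanSpace ℝ (Fin d))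
  subset_closure_interior : Ω ⊆ closure (interior Ω)
  uniqueDiffOn : UniqueDiffOn ℝ Ω
  uniqueDiffOn_closure : UniqueDiffOn ℝ (closure Ω)
  Ωm : Set (EuclideanSpace ℝ (Fin d))
  Ωm_subset : Ωm ⊆ closure Ω
  /-- order of `𝓝` in the solution `u` -/
  n : ℕ
  /-- order of `𝓝` in the target `s` -/
  m : ℕ
  /-- order of `𝓑` -/
  r : ℕ
  /-- `𝓝(u, s)(x)` as a function of `x` and of the derivatives of `u` and `s` at `x` -/
  symbolN : EuclideanSpace ℝ (Fin d) → Jet d n → Jet d m → ℝ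
  /-- `𝓑(u)(x)` as a function of `x` and of the derivatives of `u` at `x` -/
  symbolB : EuclideanSpace ℝ (Fin d) → Jet d r → ℝ

namespace InverseProblem

variable {d : ℕ} (P : InverseProblem d)

/-- The differential operator `𝓝(u, s)`, at a point `x` of `Ω`. -/
def opN (u s : EuclideanSpace ℝ (Fin d) → ℝ) (x : EuclideanSpace ℝ (Fin d)) : ℝ :=
  P.symbolN x (jetWithin P.n u P.Ω x) (jetWithin P.m s P.Ω x)

/-- The boundary operator `𝓑(u)`, at a point `x` of `∂Ω`; the derivatives are taken within the
closed domain. -/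
def opB (u : EuclideanSpace ℝ (Fin d) → ℝ) (x : EuclideanSpace ℝ (Fin d)) : ℝ :=
  P.symbolB x (jetWithin P.r u (closure P.Ω) x)

/-- `u` is a classical solution of the boundary value problem for the target `s`. Only the values
of `u` on the closure of `Ω` and of `s` on `Ω` matter. -/
structure IsSolution (u s : EuclideanSpace ℝ (Fin d) → ℝ) : Prop where
  contDiffOn_u : ContDiffOn ℝ P.n u P.Ω
  contDiffOn_u_closure : ContDiffOn ℝ P.r u (closure P.Ω)
  contDiffOn_s : ContDiffOn ℝ P.m s P.Ω
  pde : ∀ x ∈ P.Ω, P.opN u s x = 0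
  boundary : ∀ x ∈ frontier P.Ω, P.opB u x = 0

end InverseProblem

/-! ### The operator network and its losses -/

/-- The function `x ↦ b · t_θ(x) = ∑ h, b_h t_{θ,h}(x)`, where `b` is the output of a branch network
on the measurement vector `y` and `t_θ` is the trunk network. -/
def netFun {L d p D D' : ℕ} (σb σt : ℝ → ℝ) (branch : MLP D L p) (trunk : MLP D' d p)
    (y : Fin L → ℝ) (x : EuclideanSpace ℝ (Fin d)) : ℝ :=
  ∑ h : Fin p, branch.eval σb y h * trunk.eval σt (fun j => x j) h

/-- The physics loss of the reconstructions `v i` and targets `w i`, `i = 1, …, N`, at interior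
collocation points `xΩ` and boundary collocation points `xB`. -/
def physicsLoss {d N K M : ℕ} (P : InverseProblem d)
    (xΩ : Fin K → EuclideanSpace ℝ (Fin d)) (xB : Fin M → EuclideanSpace ℝ (Fin d))
    (v w : Fin N → EuclideanSpace ℝ (Fin d) → ℝ) : ℝ :=
  1 / ((N : ℝ) * (K : ℝ)) * ∑ i : Fin N, ∑ k : Fin K, (P.opN (v i) (w i) (xΩ k)) ^ 2
    + 1 / ((N : ℝ) * (M : ℝ)) * ∑ i : Fin N, ∑ j : Fin M, (P.opB (v i) (xB j)) ^ 2

/-- The data loss of the reconstructions `v i` at the measurement points `xm`, where `y i l` is the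
measured value of the `i`-th sample at `xm l`. -/
def dataLoss {d N L : ℕ} (xm : Fin L → EuclideanSpace ℝ (Fin d)) (y : Fin N → Fin L → ℝ)
    (v : Fin N → EuclideanSpace ℝ (Fin d) → ℝ) : ℝ :=
  1 / ((N : ℝ) * (L : ℝ)) * ∑ i : Fin N, ∑ l : Fin L, (v i (xm l) - y i l) ^ 2

end

end PIDION

/-! The loss can be made exactly zero. It involves only finitely many jets, so with `p = 2N` it
suffices that the trunk coordinates have the jets of the `u i` and `s i` at the chosen points, and
that each branch outputs a unit vector selecting a coordinate. The branches cannot tell apart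
samples with equal measurements; such samples share one representative pair, which solves the same
problem and has the same data.

Everything rests on Hermite interpolation by networks, `exists_network_jet_eq`. For one hidden layer
this is duality (`mem_span_ridge_jets`): a functional that kills the jets of all ridge functions `σ
(⟪w, x⟫ + b)` gives, along a direction `w` separating the points, a relation `∑ c a k * s ^ k *
σ⁽ᵏ⁾(s * t a + b) = 0` for all `s`, `b`. For smooth `σ`, `j` derivatives in `s` at `0` turn it into
a moment of `c` times `σ⁽ʲ⁾(b)`. For `σ` only `C^q`, the relation is first averaged in `b`, which
preserves it and adds smoothness; since `σ` is not a polynomial, for each `j` some averaged function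
has a nonzero `j`-th derivative. So all moments vanish, and polynomial Hermite interpolation gives
`c = 0` (`ridge_coeff_eq_zero`). Density of the separating `w` and polarization then show that the
functional kills all symmetric jets.

Additional depth comes from layers that have the jet of the identity; the branches are the case `q =
0`. -/

namespace PIDION

/-! ### Smoothing by moving integrals, and detection of polynomials -/

open Filter Topology

/-- The integral of `f` over the moving window `[y, y + h]`. -/
noncomputable def movingIntegral (h : ℝ) (f : ℝ → ℝ) (y : ℝ) : ℝ := ∫ t in y..(y + h), f t

theorem hasDerivAt_movingIntegral {f : ℝ → ℝ} (hf : Continuous f) (h y : ℝ) :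
    HasDerivAt (movingIntegral h f) (f (y + h) - f y) y := by
  have key : movingIntegral h f = fun x => (∫ t in (0 : ℝ)..(x + h), f t) - ∫ t in (0 : ℝ)..x, f t := by
    funext x
    exact (intervalIntegral.integral_interval_sub_left (hf.intervalIntegrable _ _)
      (hf.intervalIntegrable _ _)).symm
  rw [key]
  have h0 : ∀ x, HasDerivAt (fun x => ∫ t in (0 : ℝ)..x, f t) (f x) x := fun x =>
    (hf.integral_hasStrictDerivAt 0 x).hasDerivAt
  exact ((h0 (y + h)).comp_add_const y h).sub (h0 y)

theorem contDiff_movingIntegral {f : ℝ → ℝ} {m : ℕ} (hf : ContDiff ℝ m f) (h : ℝ) :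
    ContDiff ℝ ((m + 1 : ℕ) : WithTop ℕ∞) (movingIntegral h f) := by
  have hd := hasDerivAt_movingIntegral hf.continuous h
  have : ((m + 1 : ℕ) : WithTop ℕ∞) = (m : WithTop ℕ∞) + 1 := by norm_cast
  rw [this, contDiff_succ_iff_deriv]
  refine ⟨fun y => (hd y).differentiableAt, by simp, ?_⟩
  rw [show deriv (movingIntegral h f) = fun y => f (y + h) - f y from funext fun y => (hd y).deriv]
  fun_prop

theorem iteratedDeriv_movingIntegral {f : ℝ → ℝ} {m : ℕ} (hf : ContDiff ℝ m f) (h : ℝ) {k : ℕ}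
    (hk : k ≤ m) : iteratedDeriv k (movingIntegral h f) = movingIntegral h (iteratedDeriv k f) := by
  induction k with
  | zero => simp
  | succ k ih =>
    rw [iteratedDeriv_succ, ih (by omega)]
    funext y
    have hc : Continuous (iteratedDeriv k f) := hf.continuous_iteratedDeriv k (by exact_mod_cast (by omega))
    have hc' : Continuous (iteratedDeriv (k + 1) f) :=
      hf.continuous_iteratedDeriv (k + 1) (by exact_mod_cast hk)
    rw [(hasDerivAt_movingIntegral hc h y).deriv]
    refine (intervalIntegral.integral_deriv_eq_sub' _ iteratedDeriv_succ.symm ?_ hc'.continuousOn).symm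
    intro x _
    exact (hf.differentiable_iteratedDeriv k (by exact_mod_cast hk)) x

theorem contDiff_iterate_movingIntegral {f : ℝ → ℝ} {m : ℕ} (hf : ContDiff ℝ m f) (h : ℝ) (j : ℕ) :
    ContDiff ℝ ((m + j : ℕ) : WithTop ℕ∞) ((movingIntegral h)^[j] f) := by
  induction j with
  | zero => simpa using hf
  | succ j ih =>
    rw [Function.iterate_succ_apply']
    exact contDiff_movingIntegral ih h

/-- Each integration lengthens the window by `h` and multiplies both the constant and the error by
at most `h`. -/
theorem abs_iterate_movingIntegral_sub_le {f : ℝ → ℝ} (hf : Continuous f) {h : ℝ} (hh : 0 ≤ h)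
    {c ε : ℝ} (j : ℕ) (y : ℝ) (H : ∀ t ∈ Set.Icc y (y + j * h), |f t - c| ≤ ε) :
    |(movingIntegral h)^[j] f y - c * h ^ j| ≤ ε * h ^ j := by
  induction j generalizing y with
  | zero => simpa using H y
  | succ j ih =>
    rw [Function.iterate_succ_apply']
    have hc : Continuous ((movingIntegral h)^[j] f) :=
      (contDiff_iterate_movingIntegral (m := 0) (contDiff_zero.2 hf) h j).continuous
    have e : movingIntegral h ((movingIntegral h)^[j] f) y - c * h ^ (j + 1)
        = ∫ t in y..(y + h), ((movingIntegral h)^[j] f t - c * h ^ j) := by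
      rw [intervalIntegral.integral_sub (hc.intervalIntegrable _ _) (by simp)]
      simp only [movingIntegral, intervalIntegral.integral_const, smul_eq_mul]
      ring
    rw [e]
    have := intervalIntegral.norm_integral_le_of_norm_le_const (a := y) (b := y + h)
      (f := fun t => (movingIntegral h)^[j] f t - c * h ^ j) (C := ε * h ^ j) ?_
    · rw [Real.norm_eq_abs] at this
      refine this.trans (le_of_eq ?_)
      rw [add_sub_cancel_left, abs_of_nonneg hh]; ring
    · intro t ht
      rw [Set.uIoc_of_le (by linarith)] at ht
      refine ih t fun s hs => H s ⟨by linarith [hs.1, ht.1], ?_⟩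
      have := hs.2; have := ht.2
      push_cast
      linarith

theorem tendsto_iterate_movingIntegral {f : ℝ → ℝ} (hf : Continuous f) (j : ℕ) (y : ℝ) :
    Tendsto (fun h => (movingIntegral h)^[j] f y / h ^ j) (𝓝[>] 0) (𝓝 (f y)) := by
  rw [Metric.tendsto_nhds]
  intro ε hε
  obtain ⟨δ, hδ, H⟩ := Metric.continuous_iff.1 hf y (ε / 2) (by positivity)
  have h1 : ∀ᶠ h : ℝ in 𝓝[>] 0, (j : ℝ) * h < δ := by
    have : Tendsto (fun h : ℝ => (j : ℝ) * h) (𝓝 0) (𝓝 (j * 0)) :=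
      (continuous_const.mul continuous_id).tendsto 0
    rw [mul_zero] at this
    exact (this.mono_left nhdsWithin_le_nhds).eventually (gt_mem_nhds hδ)
  filter_upwards [h1, self_mem_nhdsWithin] with h hh hpos
  have hpos : 0 < h := hpos
  have := abs_iterate_movingIntegral_sub_le hf hpos.le (c := f y) (ε := ε / 2) j y fun t ht => by
    have := H t (by rw [Real.dist_eq, abs_of_nonneg (by linarith [ht.1])]; linarith [ht.2])
    rw [Real.dist_eq] at this
    exact this.le
  have hp : 0 < h ^ j := pow_pos hpos j
  rw [Real.dist_eq, div_sub' hp.ne', abs_div, abs_of_pos hp, div_lt_iff₀ hp, mul_comm (h ^ j)]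
  nlinarith

theorem exists_polynomial_of_iteratedDeriv_eq_zero {j : ℕ} {f : ℝ → ℝ} (hf : ContDiff ℝ j f)
    (h0 : ∀ x, iteratedDeriv j f x = 0) :
    ∃ p : Polynomial ℝ, p.degree < j ∧ ∀ x, f x = p.eval x := by
  induction j generalizing f with
  | zero => exact ⟨0, by simp, by simpa using h0⟩
  | succ j ih =>
    have hf' : ContDiff ℝ ((j : WithTop ℕ∞) + 1) f := by exact_mod_cast hf
    obtain ⟨p, hp, hfp⟩ := ih (contDiff_succ_iff_deriv.1 hf').2.2 (by simpa [iteratedDeriv_succ'] using h0)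
    let P : Polynomial ℝ := ∑ i ∈ Finset.range j, Polynomial.monomial (i + 1) (p.coeff i / (i + 1))
    have hP : Polynomial.derivative P = p := by
      ext i
      have hi : (i : ℝ) + 1 ≠ 0 := by positivity
      rw [Polynomial.coeff_derivative]
      simp only [P, Polynomial.finsetSum_coeff, Polynomial.coeff_monomial, Nat.add_right_cancel_iff,
        Finset.sum_ite_eq', Finset.mem_range]
      split_ifs with h
      · rw [div_mul_cancel₀ _ hi]
      · rw [(Polynomial.degree_lt_iff_coeff_zero p j).1 hp i (by omega), zero_mul]
    have hPdeg : P.degree < (j + 1 : ℕ) := by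
      rw [Polynomial.degree_lt_iff_coeff_zero]
      intro m hm
      simp only [P, Polynomial.finsetSum_coeff, Polynomial.coeff_monomial]
      refine Finset.sum_eq_zero fun i hi => if_neg ?_
      have := Finset.mem_range.1 hi
      omega
    have hdiff : Differentiable ℝ f := (contDiff_succ_iff_deriv.1 hf').1
    have hconst : ∀ x, f x - P.eval x = f 0 - P.eval 0 := by
      intro x
      refine is_const_of_deriv_eq_zero (f := fun x => f x - P.eval x) (hdiff.sub P.differentiable) ?_ x 0
      intro x
      rw [deriv_fun_sub (hdiff x) P.differentiableAt, Polynomial.deriv, hP, hfp, sub_self]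
    refine ⟨P + Polynomial.C (f 0 - P.eval 0), ?_, fun x => ?_⟩
    · refine (Polynomial.degree_add_le _ _).trans_lt (max_lt hPdeg ?_)
      exact Polynomial.degree_C_le.trans_lt (by exact_mod_cast Nat.succ_pos j)
    · rw [Polynomial.eval_add, Polynomial.eval_C, ← hconst x]; ring

/-- A pointwise limit of polynomials of bounded degree is a polynomial. -/
theorem exists_polynomial_of_tendsto {α : Type*} {l : Filter α} [l.NeBot] {j : ℕ} {f : ℝ → ℝ}
    {F : α → ℝ → ℝ} (hF : ∀ᶠ a in l, ∃ p : Polynomial ℝ, p.degree < j ∧ ∀ x, F a x = p.eval x)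
    (hlim : ∀ x, Tendsto (fun a => F a x) l (𝓝 (f x))) :
    ∃ p : Polynomial ℝ, ∀ x, f x = p.eval x := by
  have hinj : Set.InjOn (fun i : ℕ => (i : ℝ)) (Finset.range j : Finset ℕ) :=
    fun a _ b _ h => Nat.cast_injective h
  -- A polynomial of degree below `j` is recovered linearly from its values at `0, …, j - 1`, so the
  -- recovery formula passes to the pointwise limit.
  refine ⟨Lagrange.interpolate (Finset.range j) (fun i : ℕ => (i : ℝ)) fun i => f i, fun x => ?_⟩
  refine tendsto_nhds_unique (hlim x) ?_
  have h1 : Tendsto (fun a => (Lagrange.interpolate (Finset.range j) (fun i : ℕ => (i : ℝ))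
      fun i => F a i).eval x) l (𝓝 ((Lagrange.interpolate (Finset.range j) (fun i : ℕ => (i : ℝ))
      fun i => f i).eval x)) := by
    simp only [Lagrange.interpolate_apply, Polynomial.eval_finsetSum, Polynomial.eval_mul,
      Polynomial.eval_C]
    exact tendsto_finsetSum _ fun i _ => (hlim i).mul_const _
  refine h1.congr' ?_
  filter_upwards [hF] with a ⟨p, hp, hFp⟩
  have := Lagrange.eq_interpolate (s := Finset.range j) (f := p) hinj (by simpa using hp)
  rw [hFp x]
  conv_rhs => rw [this]
  simp only [hFp]

/-- Otherwise every `j`-fold moving integral of `σ` is a polynomial of degree below `j`; dividing by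
`h ^ j` and letting `h → 0⁺` makes `σ` itself a polynomial. -/
theorem exists_iteratedDeriv_iterate_movingIntegral_ne_zero {σ : ℝ → ℝ} (hσ : Continuous σ)
    (hσ' : NonPolynomial σ) (j : ℕ) :
    ∃ h b, iteratedDeriv j ((movingIntegral h)^[j] σ) b ≠ 0 := by
  by_contra! H
  refine hσ' (exists_polynomial_of_tendsto (j := j) (l := 𝓝[>] (0 : ℝ))
    (F := fun h y => (movingIntegral h)^[j] σ y / h ^ j) ?_ (tendsto_iterate_movingIntegral hσ j))
  refine Eventually.of_forall fun h => ?_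
  obtain ⟨p, hp, hfp⟩ := exists_polynomial_of_iteratedDeriv_eq_zero (j := j)
    (f := (movingIntegral h)^[j] σ)
    (by simpa using contDiff_iterate_movingIntegral (m := 0) (contDiff_zero.2 hσ) h j) (H h)
  refine ⟨Polynomial.C (h ^ j)⁻¹ * p, ?_, fun x => ?_⟩
  · refine lt_of_le_of_lt ?_ hp
    rw [← Polynomial.smul_eq_C_mul]
    exact Polynomial.degree_smul_le _ _
  · simp [hfp, div_eq_inv_mul]

/-! ### Linear relations between derivatives of ridge functions in one variable -/

section RidgeRelation

variable {ι : Type*} [Fintype ι] {q : ℕ} {t : ι → ℝ} {c : ι → ℕ → ℝ}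

/-- Integrate the relation over the shift from `b` to `b + h`; moving integrals commute with the
derivatives involved. -/
theorem ridge_relation_movingIntegral {f : ℝ → ℝ} {m : ℕ} (hqm : q ≤ m) (hf : ContDiff ℝ m f) (h : ℝ)
    (hrel : ∀ s b, ∑ a, ∑ k ∈ Finset.range (q + 1),
      c a k * (s ^ k * iteratedDeriv k f (s * t a + b)) = 0) (s b : ℝ) :
    ∑ a, ∑ k ∈ Finset.range (q + 1),
      c a k * (s ^ k * iteratedDeriv k (movingIntegral h f) (s * t a + b)) = 0 := by
  have hc : ∀ k ∈ Finset.range (q + 1), Continuous (iteratedDeriv k f) := fun k hk =>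
    hf.continuous_iteratedDeriv k (by
      have := Finset.mem_range.1 hk
      exact_mod_cast (by omega))
  have e : ∀ a, ∀ k ∈ Finset.range (q + 1),
      c a k * (s ^ k * iteratedDeriv k (movingIntegral h f) (s * t a + b))
        = ∫ u in (0 : ℝ)..h, c a k * (s ^ k * iteratedDeriv k f (s * t a + (b + u))) := by
    intro a k hk
    have := Finset.mem_range.1 hk
    rw [iteratedDeriv_movingIntegral hf h (by omega), intervalIntegral.integral_const_mul,
      intervalIntegral.integral_const_mul]
    simp only [← add_assoc]
    rw [intervalIntegral.integral_comp_add_left (fun u => iteratedDeriv k f u), add_zero]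
    rfl
  rw [Finset.sum_congr rfl fun a _ => Finset.sum_congr rfl (e a)]
  have hi : ∀ a, ∀ k ∈ Finset.range (q + 1), IntervalIntegrable
      (fun u => c a k * (s ^ k * iteratedDeriv k f (s * t a + (b + u)))) MeasureTheory.volume 0 h := by
    intro a k hk
    have := hc k hk
    exact Continuous.intervalIntegrable (by fun_prop) _ _
  rw [Finset.sum_congr rfl fun a _ => (intervalIntegral.integral_finsetSum (hi a)).symm,
    ← intervalIntegral.integral_finsetSum fun a _ => by
      have := IntervalIntegrable.sum (Finset.range (q + 1)) (hi a)
      simpa only [Finset.sum_fn] using this]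
  simp [hrel]

theorem ridge_relation_iterate_movingIntegral {f : ℝ → ℝ} (hf : ContDiff ℝ q f) (h : ℝ)
    (hrel : ∀ s b, ∑ a, ∑ k ∈ Finset.range (q + 1),
      c a k * (s ^ k * iteratedDeriv k f (s * t a + b)) = 0) (j : ℕ) (s b : ℝ) :
    ∑ a, ∑ k ∈ Finset.range (q + 1),
      c a k * (s ^ k * iteratedDeriv k ((movingIntegral h)^[j] f) (s * t a + b)) = 0 := by
  induction j generalizing s b with
  | zero => exact hrel s b
  | succ j ih =>
    rw [Function.iterate_succ_apply']
    exact ridge_relation_movingIntegral (Nat.le_add_right q j)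
      (contDiff_iterate_movingIntegral hf h j) h ih s b

/-- In Leibniz' rule at `0` only the term with exactly `k` derivatives on `s ^ k` survives. For `j <
k` the truncated `j - k` is harmless, as `descFactorial` vanishes. -/
theorem iteratedDeriv_pow_mul_comp {g : ℝ → ℝ} {j : ℕ} (hg : ContDiff ℝ j g) (k : ℕ) (t b : ℝ) :
    iteratedDeriv j (fun s => s ^ k * g (s * t + b)) 0
      = j.descFactorial k * t ^ (j - k) * iteratedDeriv (j - k) g b := by
  have hg' : ContDiff ℝ j fun x => g (x + b) := by fun_prop
  rw [iteratedDeriv_fun_mul (by fun_prop) (by fun_prop)]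
  have e : ∀ i ≤ j, iteratedDeriv i (fun s => g (s * t + b)) 0 = t ^ i * iteratedDeriv i g b := by
    intro i hi
    have := iteratedDeriv_comp_const_mul (n := i) (f := fun x => g (x + b))
      (hg'.of_le (by exact_mod_cast hi)) t
    have := congrFun this 0
    simp only [iteratedDeriv_comp_add_const, mul_zero, zero_add] at this
    rw [← this]
    simp only [mul_comm]
  simp only [iteratedDeriv_fun_pow_zero]
  by_cases hk : k ≤ j
  · rw [Finset.sum_eq_single k]
    · rw [if_pos rfl, e _ (Nat.sub_le _ _), Nat.descFactorial_eq_factorial_mul_choose]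
      push_cast
      ring
    · intro i _ hi
      simp [hi]
    · intro h
      exact absurd (Finset.mem_range.2 (by omega)) h
  · rw [Nat.descFactorial_eq_zero_iff_lt.2 (by omega)]
    rw [Finset.sum_eq_zero]
    · simp
    · intro i hi
      have := Finset.mem_range.1 hi
      rw [if_neg (by omega)]
      simp

/-- Differentiate `j` times in `s` at `0`: the remaining `j - k` derivatives of `f⁽ᵏ⁾` always give
`f⁽ʲ⁾(b)`, which factors out. -/
theorem ridge_relation_iteratedDeriv {f : ℝ → ℝ} {j : ℕ}
    (hf : ContDiff ℝ ((q + j : ℕ) : WithTop ℕ∞) f)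
    (hrel : ∀ s b, ∑ a, ∑ k ∈ Finset.range (q + 1),
      c a k * (s ^ k * iteratedDeriv k f (s * t a + b)) = 0) (b : ℝ) :
    (∑ a, ∑ k ∈ Finset.range (q + 1), c a k * (j.descFactorial k * t a ^ (j - k)))
      * iteratedDeriv j f b = 0 := by
  have hg : ∀ k ∈ Finset.range (q + 1), ContDiff ℝ j (iteratedDeriv k f) := by
    intro k hk
    have := Finset.mem_range.1 hk
    rw [iteratedDeriv_eq_iterate]
    refine ContDiff.iterate_deriv' j k (hf.of_le ?_)
    exact_mod_cast (by omega)
  have h0 := congrArg (fun F : ℝ → ℝ => iteratedDeriv j F 0) (funext fun s => hrel s b)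
  simp only [iteratedDeriv_const] at h0
  rw [iteratedDeriv_fun_sum] at h0
  · rw [Finset.sum_mul]
    rw [show (if j = 0 then (0 : ℝ) else 0) = 0 by simp] at h0
    rw [← h0]
    refine Finset.sum_congr rfl fun a _ => ?_
    rw [iteratedDeriv_fun_sum, Finset.sum_mul]
    · refine Finset.sum_congr rfl fun k hk => ?_
      have := hg k hk
      rw [iteratedDeriv_const_mul_field, iteratedDeriv_pow_mul_comp (hg k hk)]
      by_cases hkj : k ≤ j
      · have e : iteratedDeriv (j - k) (iteratedDeriv k f) = iteratedDeriv j f := by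
          simp only [iteratedDeriv_eq_iterate, ← Function.iterate_add_apply]
          rw [Nat.sub_add_cancel hkj]
        rw [e]; ring
      · rw [Nat.descFactorial_eq_zero_iff_lt.2 (by omega)]
        simp
    · intro k hk
      have := hg k hk
      fun_prop
  · intro a _
    refine ContDiff.contDiffAt (ContDiff.sum fun k hk => ?_)
    have := hg k hk
    fun_prop

/-- The hypothesis says that the functional `p ↦ ∑ c a k * p⁽ᵏ⁾(t a)` kills all monomials, hence all
polynomials; suitable test polynomials isolate one coefficient. -/
theorem hermite_coeff_eq_zero (ht : Function.Injective t)
    (hmom : ∀ j : ℕ, ∑ a, ∑ k ∈ Finset.range (q + 1),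
      c a k * (j.descFactorial k * t a ^ (j - k)) = 0) (a : ι) {k : ℕ} (hk : k ≤ q) : c a k = 0 := by
  classical
  have hpoly : ∀ p : Polynomial ℝ, ∑ a, ∑ k ∈ Finset.range (q + 1),
      c a k * (Polynomial.derivative^[k] p).eval (t a) = 0 := by
    intro p
    induction p using Polynomial.induction_on' with
    | add p₁ p₂ h₁ h₂ =>
      simp only [iterate_map_add, Polynomial.eval_add, mul_add,
        Finset.sum_add_distrib, h₁, h₂, add_zero]
    | monomial n r =>
      have := congrArg (r * ·) (hmom n)
      simp only [Finset.mul_sum, mul_zero] at this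
      rw [← this]
      refine Finset.sum_congr rfl fun a _ => Finset.sum_congr rfl fun k _ => ?_
      rw [← Polynomial.C_mul_X_pow_eq_monomial, Polynomial.iterate_derivative_C_mul,
        Polynomial.iterate_derivative_X_pow_eq_C_mul]
      simp only [Polynomial.eval_mul, Polynomial.eval_C, Polynomial.eval_pow, Polynomial.eval_X]
      ring
  -- Downward induction on `k`: the test polynomial below vanishes to order `q + 1` at the other
  -- nodes and to order exactly `k` at `t a`, so only the already known coefficients of index above
  -- `k` could interfere.
  induction hn : q - k using Nat.strong_induction_on generalizing k with
  | _ n ih =>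
    let Q : Polynomial ℝ := ∏ b ∈ Finset.univ.erase a, (Polynomial.X - Polynomial.C (t b)) ^ (q + 1)
    let p : Polynomial ℝ := (Polynomial.X - Polynomial.C (t a)) ^ k * Q
    have hQ : Q.eval (t a) ≠ 0 := by
      simp only [Q, Polynomial.eval_prod, Polynomial.eval_pow, Polynomial.eval_sub,
        Polynomial.eval_X, Polynomial.eval_C]
      refine Finset.prod_ne_zero_iff.2 fun b hb => pow_ne_zero _ (sub_ne_zero.2 ?_)
      exact fun h => (Finset.mem_erase.1 hb).1 (ht h).symm
    have hdvd : ∀ (P : Polynomial ℝ) (x : ℝ) (N i : ℕ), i < N →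
        (Polynomial.X - Polynomial.C x) ^ N ∣ P → (Polynomial.derivative^[i] P).eval x = 0 := by
      intro P x N i hi hP
      have := Polynomial.pow_sub_dvd_iterate_derivative_of_pow_dvd (n := N) i hP
      rw [← Polynomial.IsRoot.def, ← Polynomial.dvd_iff_isRoot]
      exact (dvd_pow_self _ (by omega)).trans this
    have hother : ∀ b ∈ Finset.univ.erase a, ∀ i ∈ Finset.range (q + 1),
        (Polynomial.derivative^[i] p).eval (t b) = 0 := fun b hb i hi =>
      hdvd p (t b) (q + 1) i (Finset.mem_range.1 hi)
        (Dvd.dvd.mul_left (Finset.dvd_prod_of_mem _ hb) _)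
    have hself : (Polynomial.derivative^[k] p).eval (t a) ≠ 0 := by
      have hp0 : p ≠ 0 := mul_ne_zero (pow_ne_zero _ (Polynomial.X_sub_C_ne_zero _))
        (fun h => hQ (by rw [h]; simp))
      intro h0
      have hlt := Polynomial.lt_rootMultiplicity_of_isRoot_iterate_derivative (n := k) hp0
        (t := t a) (fun m hm => by
          rcases hm.lt_or_eq with h | rfl
          · exact hdvd p (t a) k m h (dvd_mul_right _ _)
          · exact h0)
      have h1 : (Polynomial.X - Polynomial.C (t a)) ^ (k + 1) ∣ p :=
        (pow_dvd_pow _ hlt).trans (Polynomial.pow_rootMultiplicity_dvd p (t a))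
      rw [pow_succ] at h1
      have h2 := (mul_dvd_mul_iff_left (pow_ne_zero _ (Polynomial.X_sub_C_ne_zero _))).1 h1
      exact hQ (Polynomial.dvd_iff_isRoot.1 h2)
    have := hpoly p
    rw [← Finset.add_sum_erase _ _ (Finset.mem_univ a), Finset.sum_eq_zero (s := Finset.univ.erase a)
      fun b hb => Finset.sum_eq_zero fun i hi => by rw [hother b hb i hi, mul_zero], add_zero,
      Finset.sum_eq_single k] at this
    · exact (mul_eq_zero.1 this).resolve_right hself
    · intro i hi hik
      have := Finset.mem_range.1 hi
      rcases lt_or_gt_of_ne hik with h | h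
      · rw [hdvd p (t a) k i h (dvd_mul_right _ _), mul_zero]
      · rw [ih (q - i) (by omega) (by omega) rfl, zero_mul]
    · intro h
      exact absurd (Finset.mem_range.2 (by omega)) h

theorem ridge_coeff_eq_zero {σ : ℝ → ℝ} (hσ : ContDiff ℝ q σ) (hσ' : NonPolynomial σ)
    (ht : Function.Injective t)
    (hrel : ∀ s b, ∑ a, ∑ k ∈ Finset.range (q + 1),
      c a k * (s ^ k * iteratedDeriv k σ (s * t a + b)) = 0) (a : ι) {k : ℕ} (hk : k ≤ q) :
    c a k = 0 := by
  refine hermite_coeff_eq_zero ht (fun j => ?_) a hk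
  obtain ⟨h, b, hb⟩ := exists_iteratedDeriv_iterate_movingIntegral_ne_zero hσ.continuous hσ' j
  exact (mul_eq_zero.1 (ridge_relation_iteratedDeriv (contDiff_iterate_movingIntegral hσ h j)
    (ridge_relation_iterate_movingIntegral hσ h hrel j) b)).resolve_right hb

end RidgeRelation

end PIDION

/-! ### Jets of ridge functions in several variables -/

namespace PIDION

open Filter Topology

/-- Polarization, in coordinates: if the form `w ↦ ∑ f, β f * ∏ i, w (f i)` vanishes, then `β` is
orthogonal to all symmetric tensors. -/
theorem sum_mul_eq_zero_of_symmetric {d k : ℕ} {α β : (Fin k → Fin d) → ℝ}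
    (hβ : ∀ w : EuclideanSpace ℝ (Fin d), ∑ f, β f * ∏ i, w (f i) = 0)
    (hα : ∀ f (π : Equiv.Perm (Fin k)), α (f ∘ π) = α f) : ∑ f, β f * α f = 0 := by
  let M : EuclideanSpace ℝ (Fin d) [×k]→L[ℝ] ℝ :=
    ∑ f : Fin k → Fin d, β f • (ContinuousMultilinearMap.mkPiAlgebra ℝ (Fin k) ℝ).compContinuousLinearMap
      fun i => EuclideanSpace.proj (f i)
  have hM : ∀ v, M v = ∑ f, β f * ∏ i, v i (f i) := by
    intro v
    simp [M]
  have hsym : ∀ g : Fin k → Fin d, ∑ π : Equiv.Perm (Fin k), β (g ∘ π) = 0 := by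
    intro g
    -- The `k`-th derivative of the vanishing form on the diagonal, evaluated at basis vectors, is
    -- the symmetrization of `β`.
    have h1 := M.iteratedFDeriv_comp_diagonal 0 fun i => EuclideanSpace.single (g i) (1 : ℝ)
    have h2 : (fun x => M fun _ => x) = fun _ => 0 := funext fun x => by rw [hM, hβ]
    rw [h2, iteratedFDeriv_fun_zero] at h1
    refine Eq.trans ?_ h1.symm
    · refine Finset.sum_congr rfl fun π _ => ?_
      rw [hM, Finset.sum_eq_single (g ∘ π)]
      · simp
      · intro f _ hf
        obtain ⟨i, hi⟩ := Function.ne_iff.1 hf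
        rw [Finset.prod_eq_zero (Finset.mem_univ i), mul_zero]
        simpa [Pi.single_apply] using hi
      · simp
  have h3 : ∑ π : Equiv.Perm (Fin k), ∑ f, β (f ∘ π) * α (f ∘ π) = 0 := by
    rw [Finset.sum_comm]
    refine Finset.sum_eq_zero fun f _ => ?_
    simp only [hα, ← Finset.sum_mul, hsym, zero_mul]
  have h4 : ∀ π : Equiv.Perm (Fin k), ∑ f, β (f ∘ π) * α (f ∘ π) = ∑ f, β f * α f := fun π =>
    Equiv.sum_comp (Equiv.arrowCongr π.symm (Equiv.refl (Fin d))) fun f => β f * α f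
  simp only [h4, Finset.sum_const, smul_eq_zero] at h3
  exact h3.resolve_left (by simp)

/-- Directions that fail to separate lie in finitely many hyperplanes orthogonal to differences of
points; Baire's theorem applies to the open dense complements. -/
theorem dense_injOn_inner {E : Type*} [NormedAddCommGroup E] [InnerProductSpace ℝ E] [CompleteSpace E]
    (S : Finset E) : Dense {w : E | Set.InjOn (fun z => inner ℝ w z) (S : Set E)} := by
  classical
  have key : Dense (⋂ z ∈ ((S ×ˢ S).filter fun z => z.1 ≠ z.2 : Finset (E × E)),
      {w : E | inner ℝ w (z.1 - z.2) ≠ 0}) := by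
    refine dense_biInter_of_isOpen (S := (((S ×ˢ S).filter fun z => z.1 ≠ z.2 : Finset (E × E)) : Set (E × E)))
      (f := fun z => {w : E | inner ℝ w (z.1 - z.2) ≠ 0}) (fun z _ => ?_)
      (Finset.countable_toSet _) fun z hz => ?_
    · exact isOpen_ne_fun (by fun_prop) continuous_const
    · have hne : z.1 - z.2 ≠ 0 := sub_ne_zero.2 (Finset.mem_filter.1 hz).2
      let K : Submodule ℝ E := LinearMap.ker (innerSL ℝ (z.1 - z.2)).toLinearMap
      have hK : {w : E | inner ℝ w (z.1 - z.2) ≠ 0} = (K : Set E)ᶜ := by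
        ext w
        simp [K, real_inner_comm, inner_sub_right]
      rw [hK, ← interior_eq_empty_iff_dense_compl]
      by_contra hint
      have htop := K.eq_top_of_nonempty_interior' (Set.nonempty_iff_ne_empty.2 hint)
      have : z.1 - z.2 ∈ K := htop ▸ Submodule.mem_top
      simp only [K, LinearMap.mem_ker] at this
      exact hne (inner_self_eq_zero.1 this)
  refine key.mono fun w hw x hx y hy hxy => ?_
  by_contra hne
  have := Set.mem_iInter₂.1 hw (x, y) (by simp_all)
  simp only [Set.mem_ofPred_eq, inner_sub_right] at this
  exact this (sub_eq_zero.2 hxy)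

/-- In coordinates, symmetric jets at finitely many points are spanned by the jets of the ridge
functions `x ↦ σ (⟪w, x⟫ + b)`. -/
theorem mem_span_ridge_jets {d q : ℕ} {σ : ℝ → ℝ} (hσ : ContDiff ℝ q σ) (hσ' : NonPolynomial σ)
    (S : Finset (EuclideanSpace ℝ (Fin d)))
    (α : (Σ _ : S, Σ k : Fin (q + 1), Fin k → Fin d) → ℝ)
    (hα : ∀ z (k : Fin (q + 1)) f (π : Equiv.Perm (Fin k)), α ⟨z, k, f ∘ π⟩ = α ⟨z, k, f⟩) :
    α ∈ Submodule.span ℝ (Set.range fun (u : EuclideanSpace ℝ (Fin d) × ℝ)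
      (i : Σ _ : S, Σ k : Fin (q + 1), Fin k → Fin d) =>
        iteratedDeriv i.2.1 σ (inner ℝ u.1 (i.1 : EuclideanSpace ℝ (Fin d)) + u.2)
          * ∏ l, u.1 (i.2.2 l)) := by
  classical
  by_contra hmem
  obtain ⟨Λ, hΛα, hΛ⟩ := Submodule.exists_le_ker_of_notMem hmem
  let β : (Σ _ : S, Σ k : Fin (q + 1), Fin k → Fin d) → ℝ := fun i => Λ (Pi.single i 1)
  have hΛβ : ∀ v, Λ v = ∑ z, ∑ k, ∑ f, β ⟨z, k, f⟩ * v ⟨z, k, f⟩ := by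
    intro v
    rw [Λ.pi_apply_eq_sum_univ v, Fintype.sum_sigma]
    refine Finset.sum_congr rfl fun z _ => ?_
    rw [Fintype.sum_sigma]
    refine Finset.sum_congr rfl fun k _ => Finset.sum_congr rfl fun f _ => ?_
    rw [smul_eq_mul, mul_comm]
    congr 2
    ext i
    simp [Pi.single_apply, eq_comm]
  let c : EuclideanSpace ℝ (Fin d) → S → ℕ → ℝ := fun w z k =>
    if h : k < q + 1 then ∑ f, β ⟨z, ⟨k, h⟩, f⟩ * ∏ l, w (f l) else 0
  have hc : ∀ w z (k : Fin (q + 1)), c w z k = ∑ f, β ⟨z, k, f⟩ * ∏ l, w (f l) := fun w z k => by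
    simp only [c, k.isLt, dif_pos, Fin.eta]
  have hgen : ∀ w ∈ {w : EuclideanSpace ℝ (Fin d) |
      Set.InjOn (fun z => inner ℝ w z) (S : Set (EuclideanSpace ℝ (Fin d)))},
      ∀ z, ∀ k : Fin (q + 1), c w z k = 0 := by
    intro w hw z k
    refine ridge_coeff_eq_zero (t := fun z : S => inner ℝ w (z : EuclideanSpace ℝ (Fin d))) hσ hσ'
      (fun x y h => Subtype.ext (hw x.2 y.2 h)) (fun s b => ?_) z (Nat.lt_succ_iff.1 k.isLt)
    -- Using the direction `s • w` produces the factor `s ^ k` in the terms of order `k`.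
    have := LinearMap.mem_ker.1 (hΛ (Submodule.subset_span ⟨(s • w, b), rfl⟩))
    rw [hΛβ] at this
    rw [← this]
    refine Finset.sum_congr rfl fun z _ => ?_
    rw [Finset.sum_range]
    refine Finset.sum_congr rfl fun k _ => ?_
    rw [hc, Finset.sum_mul]
    refine Finset.sum_congr rfl fun f _ => ?_
    simp only [PiLp.smul_apply, smul_eq_mul, Finset.prod_mul_distrib, Finset.prod_const,
      Finset.card_univ, Fintype.card_fin, real_inner_smul_left]
    ring
  have hall : ∀ (w : EuclideanSpace ℝ (Fin d)) z, ∀ k : Fin (q + 1), ∑ f, β ⟨z, k, f⟩ * ∏ l, w (f l) = 0 := by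
    intro w z k
    have hcont : Continuous fun w : EuclideanSpace ℝ (Fin d) => ∑ f, β ⟨z, k, f⟩ * ∏ l, w (f l) := by
      fun_prop
    have := hcont.ext_on (dense_injOn_inner S) (continuous_const (y := (0 : ℝ))) fun w hw => by
      simp only
      rw [← hc, hgen w hw]
    exact congrFun this w
  refine hΛα ?_
  rw [hΛβ]
  exact Finset.sum_eq_zero fun z _ => Finset.sum_eq_zero fun k _ =>
    sum_mul_eq_zero_of_symmetric (fun w => hall w z k) (hα z k)

theorem iteratedFDeriv_ridge_apply {E : Type*} [NormedAddCommGroup E] [InnerProductSpace ℝ E]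
    {σ : ℝ → ℝ} {k : ℕ} (hσ : ContDiff ℝ k σ) (w z : E) (b : ℝ) (v : Fin k → E) :
    iteratedFDeriv ℝ k (fun x => σ (inner ℝ w x + b)) z v
      = iteratedDeriv k σ (inner ℝ w z + b) * ∏ i, inner ℝ w (v i) := by
  have h1 : (fun x => σ (inner ℝ w x + b)) = (fun t => σ (t + b)) ∘ innerSL ℝ w := rfl
  have h2 : ContDiff ℝ k fun t => σ (t + b) := by fun_prop
  rw [h1, (innerSL ℝ w).iteratedFDeriv_comp_right h2 z le_rfl,
    ContinuousMultilinearMap.compContinuousLinearMap_apply,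
    iteratedFDeriv_apply_eq_iteratedDeriv_mul_prod, iteratedDeriv_comp_add_const, smul_eq_mul,
    mul_comm]
  rfl

/-- Linear combinations of finitely many ridge functions attain prescribed symmetric jets. -/
theorem exists_sum_ridge_jet_eq {d q : ℕ} {σ : ℝ → ℝ} (hσ : ContDiff ℝ q σ) (hσ' : NonPolynomial σ)
    (S : Finset (EuclideanSpace ℝ (Fin d)))
    (A : EuclideanSpace ℝ (Fin d) → (k : ℕ) → EuclideanSpace ℝ (Fin d) [×k]→L[ℝ] ℝ)
    (hA : ∀ z ∈ S, ∀ k ≤ q, ∀ v (π : Equiv.Perm (Fin k)), A z k (v ∘ π) = A z k v) :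
    ∃ c : EuclideanSpace ℝ (Fin d) × ℝ →₀ ℝ, ∀ U, c.support ⊆ U → ∀ z ∈ S, ∀ k ≤ q,
      iteratedFDeriv ℝ k (fun x => ∑ u ∈ U, c u * σ (inner ℝ u.1 x + u.2)) z = A z k := by
  obtain ⟨c, hc⟩ := Finsupp.mem_span_range_iff_exists_finsupp.1 (mem_span_ridge_jets hσ hσ' S
    (fun i => A i.1 i.2.1 fun l => EuclideanSpace.single (i.2.2 l) 1)
    (fun z k f π => hA z z.2 k (Nat.lt_succ_iff.1 k.isLt) (fun l => EuclideanSpace.single (f l) 1) π))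
  -- The set `U` may be any finite set containing the support, so that several outputs can share one
  -- hidden layer.
  refine ⟨c, fun U hU z hz k hk => ?_⟩
  have hσk : ContDiff ℝ k σ := hσ.of_le (by exact_mod_cast hk)
  apply ContinuousMultilinearMap.toMultilinearMap_injective
  refine Module.Basis.ext_multilinear (fun _ => (EuclideanSpace.basisFun (Fin d) ℝ).toBasis) fun f => ?_
  have := congrFun hc ⟨⟨z, hz⟩, ⟨k, Nat.lt_succ_iff.2 hk⟩, f⟩
  rw [Finsupp.sum_of_support_subset c hU _ (by simp)] at this
  simp only [OrthonormalBasis.coe_toBasis, EuclideanSpace.basisFun_apply,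
    ContinuousMultilinearMap.coe_coe]
  refine Eq.trans ?_ this
  have hcd : ∀ u : EuclideanSpace ℝ (Fin d) × ℝ, ContDiff ℝ k fun x => σ (inner ℝ u.1 x + u.2) :=
    fun u => hσk.comp ((innerSL ℝ u.1).contDiff.add contDiff_const)
  rw [iteratedFDeriv_fun_sum_apply fun u _ => (contDiff_const.mul (hcd u)).contDiffAt,
    sum_apply, Finset.sum_apply]
  refine Finset.sum_congr rfl fun u _ => ?_
  have h1 := iteratedFDeriv_const_smul_apply' (𝕜 := ℝ) (i := k) (a := c u)
    (f := fun x => σ (inner ℝ u.1 x + u.2)) (x := z) (hcd u).contDiffAt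
  simp only [smul_eq_mul] at h1
  rw [h1, smul_apply, iteratedFDeriv_ridge_apply hσk]
  simp [EuclideanSpace.inner_single_right]

end PIDION

/-! ### Symmetry of higher derivatives within a set -/

namespace PIDION

/-- Iterated derivatives within a set are symmetric, at points accumulated by its interior. -/
theorem iteratedFDerivWithin_comp_perm_of_contDiffOn {E F : Type*} [NormedAddCommGroup E]
    [NormedSpace ℝ E] [NormedAddCommGroup F] [NormedSpace ℝ F] {f : E → F} {s : Set E} {k : ℕ}
    (hf : ContDiffOn ℝ k f s) (hs : UniqueDiffOn ℝ s) (hs' : s ⊆ closure (interior s)) {x : E}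
    (hx : x ∈ s) (v : Fin k → E) (π : Equiv.Perm (Fin k)) :
    iteratedFDerivWithin ℝ k f s x (v ∘ π) = iteratedFDerivWithin ℝ k f s x v := by
  induction k generalizing x with
  | zero => rw [Subsingleton.elim (v ∘ π) v]
  | succ k ih =>
    have hdiff : ∀ i, i < k + 1 → DifferentiableWithinAt ℝ (iteratedFDerivWithin ℝ i f s) s x :=
      fun i hi => (hf x hx).differentiableWithinAt_iteratedFDerivWithin
        (by exact_mod_cast hi) (by rwa [Set.insert_eq_of_mem hx])
    -- Adjacent transpositions generate the symmetric group.
    have hmem : π ∈ Submonoid.closure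
        (Set.range fun i : Fin k => Equiv.swap i.castSucc i.succ) := by
      rw [Equiv.Perm.mclosure_swap_castSucc_succ]; trivial
    induction hmem using Submonoid.closure_induction generalizing v with
    | one => rfl
    | mul π₁ π₂ _ _ h₁ h₂ =>
      rw [Equiv.Perm.coe_mul, ← Function.comp_assoc, h₂, h₁]
    | mem π hπ =>
      obtain ⟨i, rfl⟩ := hπ
      have hk : ContDiffOn ℝ k f s := hf.of_le (by exact_mod_cast Nat.le_succ k)
      rcases k with _ | k
      · exact i.elim0
      refine Fin.cases ?_ (fun j => ?_) i
      -- Swapping the first two slots is the symmetry of the second derivative of the `k`-th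
      -- derivative; here accumulation by the interior is needed.
      · have hG : ContDiffWithinAt ℝ 2 (iteratedFDerivWithin ℝ k f s) s x :=
          (hf x hx).iteratedFDerivWithin_right hs (by norm_cast; omega) hx
        have hsymm := hG.isSymmSndFDerivWithinAt (by simp) hs (hs' hx) hx
        have key : ∀ v : Fin (k + 2) → E, iteratedFDerivWithin ℝ (k + 2) f s x v
            = fderivWithin ℝ (fderivWithin ℝ (iteratedFDerivWithin ℝ k f s) s) s x (v 0) (v 1)
              (Fin.tail (Fin.tail v)) := by
          intro v
          have hG' : DifferentiableWithinAt ℝ (fderivWithin ℝ (iteratedFDerivWithin ℝ k f s) s) s x :=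
            (hG.fderivWithin_right (m := 1) hs (by norm_num) hx).differentiableWithinAt (by norm_num)
          rw [iteratedFDerivWithin_succ_apply_left,
            ← fderivWithin_continuousMultilinear_apply_const_apply (hs x hx) (hdiff (k + 1) (by omega))]
          simp only [iteratedFDerivWithin_succ_apply_left]
          rw [fderivWithin_continuousMultilinear_apply_const_apply (hs x hx)
              (hG'.clm_apply (differentiableWithinAt_const _)),
            fderivWithin_clm_apply (hs x hx) hG' (differentiableWithinAt_const _)]
          simp [Fin.tail]
        have htail : Fin.tail (Fin.tail (v ∘ Equiv.swap (0 : Fin (k + 1)).castSucc (0 : Fin (k + 1)).succ))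
            = Fin.tail (Fin.tail v) := by
          funext j
          simp only [Fin.tail, Function.comp]
          rw [Equiv.swap_apply_of_ne_of_ne]
          · simp [Fin.ext_iff]
          · simp [Fin.ext_iff]
        rw [key, key, htail]
        simp only [Function.comp]
        rw [show Equiv.swap (0 : Fin (k + 1)).castSucc (0 : Fin (k + 1)).succ 0 = 1 from
            Equiv.swap_apply_left _ _,
          show Equiv.swap (0 : Fin (k + 1)).castSucc (0 : Fin (k + 1)).succ 1 = 0 from
            Equiv.swap_apply_right _ _, hsymm.eq]
      -- A swap that avoids slot `0` acts inside the outermost derivative, so the induction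
      -- hypothesis, valid on all of `s`, can be differentiated.
      · have h0 : (v ∘ Equiv.swap j.succ.castSucc j.succ.succ) 0 = v 0 := by
          simp only [Function.comp]
          rw [Equiv.swap_apply_of_ne_of_ne] <;> simp [Fin.ext_iff]
        have htail : Fin.tail (v ∘ Equiv.swap j.succ.castSucc j.succ.succ)
            = Fin.tail v ∘ Equiv.swap j.castSucc j.succ := by
          funext l
          simp only [Fin.tail, Function.comp]
          congr 1
          rw [← Fin.succ_castSucc]
          exact ((Fin.succ_injective (k + 1)).map_swap j.castSucc j.succ l).symm
        rw [iteratedFDerivWithin_succ_apply_left, iteratedFDerivWithin_succ_apply_left, h0, htail,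
          ← fderivWithin_continuousMultilinear_apply_const_apply (hs x hx) (hdiff (k + 1) (by omega)),
          ← fderivWithin_continuousMultilinear_apply_const_apply (hs x hx) (hdiff (k + 1) (by omega))]
        rw [fderivWithin_congr (fun y hy => ih hk hy (Fin.tail v) _) (ih hk hx (Fin.tail v) _)]

end PIDION

/-! ### Hermite interpolation by networks -/

namespace PIDION

/-- Precomposition of a network with the affine map `x ↦ A x + e`. -/
noncomputable def MLP.precomp : {D a b : ℕ} → MLP D a b → {a' : ℕ} → Matrix (Fin a) (Fin a') ℝ →
    (Fin a → ℝ) → MLP D a' b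
  | _, _, _, .output W c, _, A, e => .output (W * A) (W.mulVec e + c)
  | _, _, _, .hidden W c rest, _, A, e => .hidden (W * A) (W.mulVec e + c) rest

theorem MLP.eval_precomp (σ : ℝ → ℝ) {D a b a' : ℕ} (n : MLP D a b) (A : Matrix (Fin a) (Fin a') ℝ)
    (e : Fin a → ℝ) (x : Fin a' → ℝ) : (n.precomp A e).eval σ x = n.eval σ (A.mulVec x + e) := by
  cases n <;> simp [MLP.precomp, MLP.eval, Matrix.mulVec_add, add_assoc]

theorem MLP.contDiff_eval {σ : ℝ → ℝ} {q : WithTop ℕ∞} (hσ : ContDiff ℝ q σ) {D a b : ℕ}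
    (n : MLP D a b) : ContDiff ℝ q (n.eval σ) := by
  have haff : ∀ {a b : ℕ} (W : Matrix (Fin b) (Fin a) ℝ) (c : Fin b → ℝ),
      ContDiff ℝ q fun x => W.mulVec x + c := fun W c =>
    (Matrix.mulVecLin W).toContinuousLinearMap.contDiff.add contDiff_const
  induction n with
  | output W c => exact haff W c
  | hidden W c rest ih =>
    exact ih.comp (contDiff_pi.2 fun j => hσ.comp (contDiff_pi.1 (haff W c) j))

/-- The derivatives at `x` of a composition `F ∘ f` only depend on those of `f` at `x`. -/
theorem iteratedFDeriv_comp_congr {E E' G : Type*} [NormedAddCommGroup E] [NormedSpace ℝ E]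
    [NormedAddCommGroup E'] [NormedSpace ℝ E'] [NormedAddCommGroup G] [NormedSpace ℝ G]
    {F : E' → G} {f g : E → E'} {x : E} {k : ℕ} (hF : ContDiff ℝ k F) (hf : ContDiff ℝ k f)
    (hg : ContDiff ℝ k g) (h : ∀ i ≤ k, iteratedFDeriv ℝ i f x = iteratedFDeriv ℝ i g x) :
    iteratedFDeriv ℝ k (F ∘ f) x = iteratedFDeriv ℝ k (F ∘ g) x := by
  have h0 : f x = g x := by
    simpa using congrArg (fun M => M 0) (h 0 (Nat.zero_le k))
  -- Faà di Bruno's formula.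
  rw [iteratedFDeriv_comp hF.contDiffAt hf.contDiffAt le_rfl,
    iteratedFDeriv_comp hF.contDiffAt hg.contDiffAt le_rfl, h0]
  refine Finset.sum_congr rfl fun c _ => ?_
  have : (fun m => ftaylorSeries ℝ f x (c.partSize m)) = fun m => ftaylorSeries ℝ g x (c.partSize m) :=
    funext fun m => h _ (c.partSize_le m)
  simp only [FormalMultilinearSeries.compAlongOrderedFinpartition, this]

theorem iteratedFDeriv_comp_perm_of_contDiff {E F : Type*} [NormedAddCommGroup E]
    [NormedSpace ℝ E] [NormedAddCommGroup F] [NormedSpace ℝ F] {f : E → F} {k : ℕ}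
    (hf : ContDiff ℝ k f) (x : E) (v : Fin k → E) (π : Equiv.Perm (Fin k)) :
    iteratedFDeriv ℝ k f x (v ∘ π) = iteratedFDeriv ℝ k f x v := by
  rw [← iteratedFDerivWithin_univ]
  exact iteratedFDerivWithin_comp_perm_of_contDiffOn hf.contDiffOn uniqueDiffOn_univ (by simp)
    (Set.mem_univ x) v π

/-- The function of `x` computed by an output coordinate of a network on Euclidean space. -/
noncomputable def MLP.coordFun (σ : ℝ → ℝ) {D d b : ℕ} (n : MLP D d b) (j : Fin b)
    (x : EuclideanSpace ℝ (Fin d)) : ℝ := n.eval σ (fun l => x l) j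

theorem MLP.contDiff_coordFun {σ : ℝ → ℝ} {q : WithTop ℕ∞} (hσ : ContDiff ℝ q σ) {D d b : ℕ}
    (n : MLP D d b) (j : Fin b) : ContDiff ℝ q (n.coordFun σ j) :=
  contDiff_pi.1 ((n.contDiff_eval hσ).comp
    (EuclideanSpace.equiv (Fin d) ℝ).toContinuousLinearMap.contDiff) j

/-- The hidden units are the union of the ridge functions needed by the individual outputs; unused
ones get coefficient zero. -/
theorem exists_one_layer_jet_eq {d b q : ℕ} {σ : ℝ → ℝ} (hσ : ContDiff ℝ q σ)
    (hσ' : NonPolynomial σ) (S : Finset (EuclideanSpace ℝ (Fin d)))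
    (A : Fin b → EuclideanSpace ℝ (Fin d) → (k : ℕ) → EuclideanSpace ℝ (Fin d) [×k]→L[ℝ] ℝ)
    (hA : ∀ j, ∀ z ∈ S, ∀ k ≤ q, ∀ v (π : Equiv.Perm (Fin k)), A j z k (v ∘ π) = A j z k v) :
    ∃ (h : ℕ) (W : Matrix (Fin h) (Fin d) ℝ) (c : Fin h → ℝ) (W' : Matrix (Fin b) (Fin h) ℝ),
      ∀ j, ∀ z ∈ S, ∀ k ≤ q,
        iteratedFDeriv ℝ k ((MLP.hidden W c (.output W' 0)).coordFun σ j) z = A j z k := by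
  classical
  choose C hC using fun j => exists_sum_ridge_jet_eq hσ hσ' S (A j) (hA j)
  let U := Finset.univ.biUnion fun j => (C j).support
  let e := U.equivFin
  refine ⟨U.card, fun h l => (e.symm h).1.1 l, fun h => (e.symm h).1.2,
    fun j h => C j (e.symm h).1, fun j z hz k hk => ?_⟩
  rw [← hC j U (Finset.subset_biUnion_of_mem (fun j => (C j).support) (Finset.mem_univ j)) z hz k hk]
  congr 1
  funext x
  rw [← Finset.sum_coe_sort U, ← Equiv.sum_comp e.symm]
  simp only [MLP.coordFun, MLP.eval, Matrix.mulVec, dotProduct, Pi.add_apply, Pi.zero_apply, add_zero,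
    PiLp.inner_apply, RCLike.inner_apply, conj_trivial]
  refine Finset.sum_congr rfl fun h _ => ?_
  congr 3
  exact Finset.sum_congr rfl fun l _ => mul_comm _ _

/-- Networks of any prescribed positive depth attain prescribed symmetric jets, up to the order of
smoothness of the activation function, at finitely many points. -/
theorem exists_network_jet_eq {d b q D : ℕ} (hD : 1 ≤ D) {σ : ℝ → ℝ} (hσ : ContDiff ℝ q σ)
    (hσ' : NonPolynomial σ) (S : Finset (EuclideanSpace ℝ (Fin d)))
    (A : Fin b → EuclideanSpace ℝ (Fin d) → (k : ℕ) → EuclideanSpace ℝ (Fin d) [×k]→L[ℝ] ℝ)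
    (hA : ∀ j, ∀ z ∈ S, ∀ k ≤ q, ∀ v (π : Equiv.Perm (Fin k)), A j z k (v ∘ π) = A j z k v) :
    ∃ n : MLP D d b, ∀ j, ∀ z ∈ S, ∀ k ≤ q, iteratedFDeriv ℝ k (n.coordFun σ j) z = A j z k := by
  induction D, hD using Nat.le_induction with
  | base =>
    obtain ⟨h, W, c, W', H⟩ := exists_one_layer_jet_eq hσ hσ' S A hA
    exact ⟨_, H⟩
  | succ D _ ih =>
    obtain ⟨n, hn⟩ := ih
    have hproj : ∀ l : Fin d, ∀ k : ℕ, ContDiff ℝ k fun x : EuclideanSpace ℝ (Fin d) => x l :=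
      fun l k => (EuclideanSpace.proj (𝕜 := ℝ) l).contDiff
    -- The added first layer has the jets of the identity on `S`, so precomposing with it leaves the
    -- jets of `n` unchanged.
    obtain ⟨h, W, c, W', H⟩ := exists_one_layer_jet_eq hσ hσ' S
      (fun l : Fin d => fun z k => iteratedFDeriv ℝ k (fun x : EuclideanSpace ℝ (Fin d) => x l) z)
      (fun l z _ k _ v π => iteratedFDeriv_comp_perm_of_contDiff (hproj l k) z v π)
    let g : EuclideanSpace ℝ (Fin d) → EuclideanSpace ℝ (Fin d) := fun x =>
      WithLp.toLp 2 fun l => (MLP.hidden W c (.output W' 0)).coordFun σ l x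
    have hg : ContDiff ℝ q g :=
      (EuclideanSpace.equiv (Fin d) ℝ).symm.toContinuousLinearMap.contDiff.comp
        (contDiff_pi.2 fun l => MLP.contDiff_coordFun hσ _ l)
    have hgjet : ∀ z ∈ S, ∀ k ≤ q, iteratedFDeriv ℝ k g z = iteratedFDeriv ℝ k id z := by
      intro z hz k hk
      have hgk : ContDiff ℝ k g := hg.of_le (by exact_mod_cast hk)
      ext v l
      have h1 := (EuclideanSpace.proj (𝕜 := ℝ) l).iteratedFDeriv_comp_left (hgk.contDiffAt (x := z))
        le_rfl
      have h2 := (EuclideanSpace.proj (𝕜 := ℝ) l).iteratedFDeriv_comp_left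
        (contDiff_id.contDiffAt (𝕜 := ℝ) (n := (k : WithTop ℕ∞)) (x := z)) le_rfl
      have h3 := congrArg (fun M => M v) (h1.symm.trans ((H l z hz k hk).trans h2))
      exact h3
    -- The affine output `W'` is absorbed into the first layer of `n`, so the depth grows by exactly
    -- one.
    refine ⟨.hidden W c (n.precomp W' 0), fun j z hz k hk => ?_⟩
    have hσk : ContDiff ℝ k σ := hσ.of_le (by exact_mod_cast hk)
    have hcomp : (MLP.hidden W c (n.precomp W' 0)).coordFun σ j = n.coordFun σ j ∘ g := by
      funext x
      simp only [MLP.coordFun, MLP.eval, MLP.eval_precomp, Function.comp, g]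
    rw [hcomp, iteratedFDeriv_comp_congr (n.contDiff_coordFun hσk j)
      (hg.of_le (by exact_mod_cast hk)) contDiff_id fun i hi => hgjet z hz i (hi.trans hk),
      Function.comp_id, hn j z hz k hk]

/-- Networks of any prescribed positive depth interpolate arbitrary values at finitely many points. -/
theorem exists_network_eval_eq {L b D : ℕ} (hD : 1 ≤ D) {σ : ℝ → ℝ} (hσ : Continuous σ)
    (hσ' : NonPolynomial σ) (S : Set (Fin L → ℝ)) (hS : S.Finite) (B : (Fin L → ℝ) → Fin b → ℝ) :
    ∃ n : MLP D L b, ∀ y ∈ S, n.eval σ y = B y := by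
  classical
  -- At each `z` the prescribed jet is that of the constant `B z`; only order `0` matters.
  obtain ⟨n, hn⟩ := exists_network_jet_eq (q := 0) (b := b) hD
    (contDiff_zero.2 hσ) hσ' (hS.toFinset.image (WithLp.toLp 2))
    (fun j z k => iteratedFDeriv ℝ k (fun _ => B z.ofLp j) z)
    (fun j z _ k _ v π => iteratedFDeriv_comp_perm_of_contDiff contDiff_const z v π)
  refine ⟨n, fun y hy => funext fun j => ?_⟩
  have := hn j (WithLp.toLp 2 y) (Finset.mem_image_of_mem _ (hS.mem_toFinset.2 hy)) 0 le_rfl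
  simpa [MLP.coordFun] using congrArg (fun M => M 0) this

end PIDION

/-! ### The jets prescribed by the boundary value problem -/

namespace PIDION

section Targets

variable {d : ℕ} (P : InverseProblem d)

open Classical in
/-- The derivatives of a solution at the points of `closure Ω`: within `Ω` where these exist, within
`closure Ω` otherwise. -/
noncomputable def InverseProblem.solutionJet (u : EuclideanSpace ℝ (Fin d) → ℝ)
    (z : EuclideanSpace ℝ (Fin d)) (k : ℕ) : EuclideanSpace ℝ (Fin d) [×k]→L[ℝ] ℝ :=
  if z ∈ P.Ω ∧ k ≤ P.n then iteratedFDerivWithin ℝ k u P.Ω z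
  else if z ∈ closure P.Ω ∧ k ≤ P.r then iteratedFDerivWithin ℝ k u (closure P.Ω) z
  else 0

open Classical in
/-- The derivatives of a target at the points of `Ω`. -/
noncomputable def InverseProblem.targetJet (s : EuclideanSpace ℝ (Fin d) → ℝ)
    (z : EuclideanSpace ℝ (Fin d)) (k : ℕ) : EuclideanSpace ℝ (Fin d) [×k]→L[ℝ] ℝ :=
  if z ∈ P.Ω ∧ k ≤ P.m then iteratedFDerivWithin ℝ k s P.Ω z else 0

variable {P} {u s : EuclideanSpace ℝ (Fin d) → ℝ}

theorem InverseProblem.IsSolution.solutionJet_comp_perm (h : P.IsSolution u s)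
    (z : EuclideanSpace ℝ (Fin d)) (k : ℕ) (v : Fin k → EuclideanSpace ℝ (Fin d))
    (π : Equiv.Perm (Fin k)) : P.solutionJet u z k (v ∘ π) = P.solutionJet u z k v := by
  unfold InverseProblem.solutionJet
  split_ifs with h₁ h₂
  · exact iteratedFDerivWithin_comp_perm_of_contDiffOn
      (h.contDiffOn_u.of_le (by exact_mod_cast h₁.2)) P.uniqueDiffOn P.subset_closure_interior h₁.1 v π
  · exact iteratedFDerivWithin_comp_perm_of_contDiffOn
      (h.contDiffOn_u_closure.of_le (by exact_mod_cast h₂.2)) P.uniqueDiffOn_closure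
      (closure_minimal (P.subset_closure_interior.trans
        (closure_mono (interior_mono subset_closure))) isClosed_closure) h₂.1 v π
  · rfl

theorem InverseProblem.IsSolution.targetJet_comp_perm (h : P.IsSolution u s)
    (z : EuclideanSpace ℝ (Fin d)) (k : ℕ) (v : Fin k → EuclideanSpace ℝ (Fin d))
    (π : Equiv.Perm (Fin k)) : P.targetJet s z k (v ∘ π) = P.targetJet s z k v := by
  unfold InverseProblem.targetJet
  split_ifs with h₁
  · exact iteratedFDerivWithin_comp_perm_of_contDiffOn
      (h.contDiffOn_s.of_le (by exact_mod_cast h₁.2)) P.uniqueDiffOn P.subset_closure_interior h₁.1 v π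
  · rfl

/-- Where both prescriptions apply they agree, by uniqueness of derivatives within both sets. Thus
one jet serves the equation, the boundary condition and the data. -/
theorem InverseProblem.IsSolution.solutionJet_closure (h : P.IsSolution u s)
    {z : EuclideanSpace ℝ (Fin d)} (hz : z ∈ closure P.Ω) {k : ℕ} (hk : k ≤ P.r) :
    P.solutionJet u z k = iteratedFDerivWithin ℝ k u (closure P.Ω) z := by
  unfold InverseProblem.solutionJet
  split_ifs with h₁ h₂
  · exact iteratedFDerivWithin_subset subset_closure P.uniqueDiffOn P.uniqueDiffOn_closure
      (h.contDiffOn_u_closure.of_le (by exact_mod_cast hk)) h₁.1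
  · rfl
  · exact absurd ⟨hz, hk⟩ h₂

theorem jetWithin_eq_of_iteratedFDeriv_eq {f g : EuclideanSpace ℝ (Fin d) → ℝ}
    {S : Set (EuclideanSpace ℝ (Fin d))} {z : EuclideanSpace ℝ (Fin d)} {n : ℕ}
    (hS : UniqueDiffOn ℝ S) (hz : z ∈ S) (hf : ContDiff ℝ n f)
    (h : ∀ k ≤ n, iteratedFDeriv ℝ k f z = iteratedFDerivWithin ℝ k g S z) :
    jetWithin n f S z = jetWithin n g S z := by
  funext i
  have hi : (i : ℕ) ≤ n := Nat.lt_succ_iff.1 i.isLt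
  have hfi : ContDiff ℝ (i : ℕ) f := hf.of_le (by exact_mod_cast hi)
  simp only [jetWithin]
  rw [iteratedFDerivWithin_eq_iteratedFDeriv hS hfi.contDiffAt hz, h i hi]

theorem netFun_eq_coordFun {L d p D D' : ℕ} {σb σt : ℝ → ℝ} {branch : MLP D L p}
    {trunk : MLP D' d p} {y : Fin L → ℝ} {j : Fin p} (h : branch.eval σb y = Pi.single j 1) :
    netFun σb σt branch trunk y = trunk.coordFun σt j := by
  funext x
  simp [netFun, h, MLP.coordFun, Pi.single_apply]

end Targets

end PIDION

/-! ### Assembling the networks -/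

open PIDION

theorem proposition1 {d : ℕ} (P : PIDION.InverseProblem d) {N K M L : ℕ}
    -- the data set: `N` solution-target pairs of the boundary value problem
    (u s : Fin N → EuclideanSpace ℝ (Fin d) → ℝ)
    (hsol : ∀ i, P.IsSolution (u i) (s i))
    -- collocation points in `Ω` and on `∂Ω`, and measurement points in `Ωm`
    (xΩ : Fin K → EuclideanSpace ℝ (Fin d)) (hxΩ : ∀ k, xΩ k ∈ P.Ω)
    (xB : Fin M → EuclideanSpace ℝ (Fin d)) (hxB : ∀ j, xB j ∈ frontier P.Ω)
    (xm : Fin L → EuclideanSpace ℝ (Fin d)) (hxm : ∀ l, xm l ∈ P.Ωm)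
    -- activations of the reconstruction branch, of the inverse branch and of the trunk
    (σrec σinv σtr : ℝ → ℝ)
    (hrec : Continuous σrec) (hrec' : PIDION.NonPolynomial σrec)
    (hinv : Continuous σinv) (hinv' : PIDION.NonPolynomial σinv)
    (htr : ContDiff ℝ ((max P.n (max P.m P.r) : ℕ) : WithTop ℕ∞) σtr)
    (htr' : PIDION.NonPolynomial σtr)
    -- prescribed numbers of hidden layers of the three networks
    (Drec Dinv Dtr : ℕ) (hDrec : 1 ≤ Drec) (hDinv : 1 ≤ Dinv) (hDtr : 1 ≤ Dtr)
    (ε : ℝ) (hε : 0 < ε) :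
    ∃ (p : ℕ) (η : PIDION.MLP Drec L p) (ζ : PIDION.MLP Dinv L p) (θ : PIDION.MLP Dtr d p),
      PIDION.physicsLoss P xΩ xB
          (fun i => PIDION.netFun σrec σtr η θ (fun l => u i (xm l)))
          (fun i => PIDION.netFun σinv σtr ζ θ (fun l => u i (xm l)))
        + PIDION.dataLoss xm (fun i l => u i (xm l))
          (fun i => PIDION.netFun σrec σtr η θ (fun l => u i (xm l))) ≤ ε := by
  classical
  set q := max P.n (max P.m P.r)
  have hn : P.n ≤ q := le_max_left _ _
  have hm : P.m ≤ q := (le_max_left _ _).trans (le_max_right _ _)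
  have hr : P.r ≤ q := (le_max_right _ _).trans (le_max_right _ _)
  have hσ : ∀ k ≤ q, ContDiff ℝ k σtr := fun k hk => htr.of_le (by exact_mod_cast hk)
  let S : Finset (EuclideanSpace ℝ (Fin d)) :=
    Finset.univ.image xΩ ∪ Finset.univ.image xB ∪ Finset.univ.image xm
  have hSΩ : ∀ k, xΩ k ∈ S := fun k => by simp [S]
  have hSB : ∀ j, xB j ∈ S := fun j => by simp [S]
  have hSm : ∀ l, xm l ∈ S := fun l => by simp [S]
  -- The shared trunk has `2N` outputs: the first `N` carry the jets of the `u i`, the last `N`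
  -- those of the `s i`.
  obtain ⟨θ, hθ⟩ := exists_network_jet_eq hDtr htr htr' S
    (Fin.addCases (fun i => P.solutionJet (u i)) (fun i => P.targetJet (s i)) :
      Fin (N + N) → EuclideanSpace ℝ (Fin d) → (k : ℕ) → EuclideanSpace ℝ (Fin d) [×k]→L[ℝ] ℝ)
    (by
      intro j z _ k _ v π
      refine Fin.addCases (fun i => ?_) (fun i => ?_) j
      · simpa only [Fin.addCases_left] using (hsol i).solutionJet_comp_perm z k v π
      · simpa only [Fin.addCases_right] using (hsol i).targetJet_comp_perm z k v π)
  -- samples with equal measurements share a representative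
  let Y : Fin N → Fin L → ℝ := fun i l => u i (xm l)
  let rep : Fin N → Fin N := fun i => Set.rangeSplitting Y ⟨Y i, Set.mem_range_self i⟩
  have hrep : ∀ i, Y (rep i) = Y i := fun i => Set.apply_rangeSplitting Y _
  have hbranch : ∀ {D : ℕ}, 1 ≤ D → ∀ {σ : ℝ → ℝ}, Continuous σ → NonPolynomial σ →
      ∀ e : Fin N → Fin (N + N),
        ∃ η : MLP D L (N + N), ∀ i, η.eval σ (Y i) = Pi.single (e (rep i)) 1 := by
    intro D hD σ hc hp e
    obtain ⟨η, hη⟩ := exists_network_eval_eq (b := N + N) hD hc hp (Set.range Y)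
      (Set.finite_range Y)
      fun y => if h : y ∈ Set.range Y then Pi.single (e (Set.rangeSplitting Y ⟨y, h⟩)) 1 else 0
    refine ⟨η, fun i => ?_⟩
    rw [hη _ (Set.mem_range_self i), dif_pos (Set.mem_range_self i)]
  -- Both branches select the same representative, so reconstruction and target come from one
  -- solution pair.
  obtain ⟨η, hη⟩ := hbranch hDrec hrec hrec' (Fin.castAdd N)
  obtain ⟨ζ, hζ⟩ := hbranch hDinv hinv hinv' (Fin.natAdd N)
  refine ⟨N + N, η, ζ, θ, ?_⟩
  have hv : (fun i => netFun σrec σtr η θ fun l => u i (xm l))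
      = fun i => θ.coordFun σtr (Fin.castAdd N (rep i)) := funext fun i => netFun_eq_coordFun (hη i)
  have hw : (fun i => netFun σinv σtr ζ θ fun l => u i (xm l))
      = fun i => θ.coordFun σtr (Fin.natAdd N (rep i)) := funext fun i => netFun_eq_coordFun (hζ i)
  rw [hv, hw]
  have hθu : ∀ i, ∀ z ∈ S, ∀ k ≤ q,
      iteratedFDeriv ℝ k (θ.coordFun σtr (Fin.castAdd N i)) z = P.solutionJet (u i) z k :=
    fun i z hz k hk => by simpa only [Fin.addCases_left] using hθ (Fin.castAdd N i) z hz k hk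
  have hθs : ∀ i, ∀ z ∈ S, ∀ k ≤ q,
      iteratedFDeriv ℝ k (θ.coordFun σtr (Fin.natAdd N i)) z = P.targetJet (s i) z k :=
    fun i z hz k hk => by simpa only [Fin.addCases_right] using hθ (Fin.natAdd N i) z hz k hk
  have hN : ∀ i k, P.opN (θ.coordFun σtr (Fin.castAdd N (rep i)))
      (θ.coordFun σtr (Fin.natAdd N (rep i))) (xΩ k) = 0 := by
    intro i k
    rw [← (hsol (rep i)).pde (xΩ k) (hxΩ k)]
    unfold InverseProblem.opN
    rw [jetWithin_eq_of_iteratedFDeriv_eq (g := u (rep i)) P.uniqueDiffOn (hxΩ k)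
        (θ.contDiff_coordFun (hσ _ hn) _) fun k' hk' => by
          rw [hθu _ _ (hSΩ k) _ (hk'.trans hn), InverseProblem.solutionJet, if_pos ⟨hxΩ k, hk'⟩],
      jetWithin_eq_of_iteratedFDeriv_eq (g := s (rep i)) P.uniqueDiffOn (hxΩ k)
        (θ.contDiff_coordFun (hσ _ hm) _) fun k' hk' => by
          rw [hθs _ _ (hSΩ k) _ (hk'.trans hm), InverseProblem.targetJet, if_pos ⟨hxΩ k, hk'⟩]]
  have hB : ∀ i j, P.opB (θ.coordFun σtr (Fin.castAdd N (rep i))) (xB j) = 0 := by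
    intro i j
    have hcl := frontier_subset_closure (hxB j)
    rw [← (hsol (rep i)).boundary (xB j) (hxB j)]
    unfold InverseProblem.opB
    rw [jetWithin_eq_of_iteratedFDeriv_eq (g := u (rep i)) P.uniqueDiffOn_closure hcl
        (θ.contDiff_coordFun (hσ _ hr) _) fun k' hk' => by
          rw [hθu _ _ (hSB j) _ (hk'.trans hr), (hsol (rep i)).solutionJet_closure hcl hk']]
  have hdata : ∀ i l, θ.coordFun σtr (Fin.castAdd N (rep i)) (xm l) = u i (xm l) := by
    intro i l
    have h0 := congrArg (fun M => M 0) (hθu (rep i) (xm l) (hSm l) 0 (Nat.zero_le q))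
    rw [(hsol (rep i)).solutionJet_closure (P.Ωm_subset (hxm l)) (Nat.zero_le _)] at h0
    simp only [iteratedFDeriv_zero_apply, iteratedFDerivWithin_zero_apply] at h0
    exact h0.trans (congrFun (hrep i) l)
  -- Every summand is zero, so the prefactors are irrelevant, even when a count is `0`.
  simp only [physicsLoss, dataLoss, hN, hB, hdata, sub_self]
  simpa using hε.le
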